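/- Let $n\ge 2$. A convex body is a nonempty compact convex subset of $\mathbb R^n$. For convex bodies $K,C$ with $0\in\operatorname{int}C$ let $$R(K,C)=\inf\{\rho\ge 0:\exists t\in\mathbb R^n,\ K\subset t+\rho C\},\qquad r(K,C)=\sup\{\rho\ge 0:\exists t\in\mathbb R^n,\ t+\rho C\subset K\}$$ be the circumradius and the inradius. Write $K\subset^{\mathrm{opt}}C$ if $K\subset C$ and $R(K,C)=1$. Let $s(C)=R(C,-C)$ be the Minkowski asymmetry, and call $C$ Minkowski-centered if $C\subset^{\mathrm{opt}}-s(C)C$. Let $h_C(a)=\max_{x\in C}a^{T}x$, $\|x\|_C=\min\{\lambda\ge 0:x\in\lambda C\}$ and $C^\circ=\{a:h_C(a)\le 1\}$, and define the symmetrizations $$C_{\mathrm{MIN}}=C\cap(-C),\quad C_{\mathrm{HM}}=\Big(\tfrac{C^\circ-C^\circ}{2}\Big)^{\circ},\quad C_{\mathrm{AM}}=\tfrac{C-C}{2},\quad C_{\mathrm{MAX}}=\operatorname{conv}(C\cup(-C)).$$ The corresponding diameters are $D_M(K,C)=\max_{s\ne 0}l_{s,M}(K,C)$ for $M\in\{\mathrm{MIN},\mathrm{HM},\mathrm{AM}\}$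 and $D_{\mathrm{MAX}}(K,C)=\max_{s\neq 0}b_{s,\mathrm{MAX}}(K,C)$, where, with maxima over $x,y\in K$ such that $x-y\in\operatorname{lin}(s)$, $$l_{s,\mathrm{MIN}}=\max\|x-y\|_C,\quad l_{s,\mathrm{HM}}=\max\tfrac12\big(\|x-y\|_C+\|x-y\|_{-C}\big),\quad l_{s,\mathrm{AM}}=\max 2R([x,y],C),$$ $$b_{s,\mathrm{MAX}}=\frac{h_K(s)+h_K(-s)}{\max(h_C(s),h_C(-s))}.$$ Let $K$ be a convex body, let $C$ be a Minkowski-centered convex body with $0\in\operatorname{int}C$, and let $M\in\{\mathrm{MIN},\mathrm{HM},\mathrm{AM},\mathrm{MAX}\}$. Then there are unique numbers $\rho_M,\delta_M>0$ with $\rho_M C_M\subset^{\mathrm{opt}}C_{\mathrm{AM}}\subset^{\mathrm{opt}}\delta_M C_M$; they satisfy $\rho_M\le\delta_M$, and 1. $\rho_M D_{\mathrm{AM}}(K,C)\le D_M(K,C)\le\delta_M D_{\mathrm{AM}}(K,C)$; 2. $\delta_M\, r(K,C)\le \frac{D_M(K,C)}{2}$; 3. $\frac{D_M(K,C)}{2}\le\delta_M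 R(K,C)$; 4. $\rho_M\big(s(C)\,r(K,C)+R(K,C)\big)\le (s(C)+1)\frac{D_M(K,C)}{2}$; 5. $r(K,C)+R(K,C)\le R(C_M,C)\,D_M(K,C)$. -/

import Mathlib

open scoped Pointwise

namespace GaugeGeometry

/-- Euclidean space of dimension `n`. -/
abbrev E (n : ℕ) : Type := EuclideanSpace ℝ (Fin n)

variable {n : ℕ}

/-- The circumradius `R(K, C)`: the infimum of all `ρ ≥ 0` such that `K` lies in a translate
of `ρ C`. -/
noncomputable def circumradius (K C : Set (E n)) : ℝ :=
  sInf {ρ : ℝ | 0 ≤ ρ ∧ ∃ t : E n, K ⊆ {t} + ρ • C}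

/-- The inradius `r(K, C)`: the supremum of all `ρ ≥ 0` such that some translate of `ρ C`
lies in `K`. -/
noncomputable def inradius (K C : Set (E n)) : ℝ :=
  sSup {ρ : ℝ | 0 ≤ ρ ∧ ∃ t : E n, {t} + ρ • C ⊆ K}

/-- `K` is optimally contained in `C`. -/
def OptContained (K C : Set (E n)) : Prop :=
  K ⊆ C ∧ circumradius K C = 1

/-- The Minkowski asymmetry `s(C) = R(C, -C)`. -/
noncomputable def asymmetry (C : Set (E n)) : ℝ :=
  circumradius C (-C)

/-- `C` is Minkowski-centered if it is optimally contained in `-s(C) C`. -/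
def MinkowskiCentered (C : Set (E n)) : Prop :=
  OptContained C ((-asymmetry C) • C)

/-- The support function `h_C(a)`, the maximum of `⟪a, x⟫` over `x ∈ C`. -/
noncomputable def supportFn (C : Set (E n)) (a : E n) : ℝ :=
  sSup ((fun x => inner ℝ a x) '' C)

/-- The (one-sided) polar of `C`: all `a` with `h_C(a) ≤ 1`. -/
def polarSet (C : Set (E n)) : Set (E n) :=
  {a | ∀ x ∈ C, inner ℝ a x ≤ 1}

/-- The four means of a gauge `C` and its reflection `-C`. -/
inductive Mean : Type
  | MIN
  | HM
  | AM
  | MAX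

/-- The symmetrization `C_M`. -/
def symmetrization : Mean → Set (E n) → Set (E n)
  | Mean.MIN, C => C ∩ -C
  | Mean.HM, C => polarSet ((1 / 2 : ℝ) • (polarSet C - polarSet C))
  | Mean.AM, C => (1 / 2 : ℝ) • (C - C)
  | Mean.MAX, C => convexHull ℝ (C ∪ -C)

/-- The arithmetic `s`-length: twice the largest circumradius of a segment with endpoints in `K`
that is parallel to `s`. -/
noncomputable def lengthAM (s : E n) (K C : Set (E n)) : ℝ :=
  sSup {d : ℝ | ∃ x ∈ K, ∃ y ∈ K, x - y ∈ Submodule.span ℝ {s} ∧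
    d = 2 * circumradius (segment ℝ x y) C}

/-- The (symmetric) minimum `s`-length: the largest value of the gauge function of `C` at a
difference `x - y` of points of `K` that is parallel to `s`. -/
noncomputable def lengthMIN (s : E n) (K C : Set (E n)) : ℝ :=
  sSup {d : ℝ | ∃ x ∈ K, ∃ y ∈ K, x - y ∈ Submodule.span ℝ {s} ∧ d = gauge C (x - y)}

/-- The harmonic `s`-length: as `lengthMIN`, with the mean of the gauge functions of `C`
and `-C`. -/
noncomputable def lengthHM (s : E n) (K C : Set (E n)) : ℝ :=
  sSup {d : ℝ | ∃ x ∈ K, ∃ y ∈ K, x - y ∈ Submodule.span ℝ {s} ∧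
    d = (1 / 2) * (gauge C (x - y) + gauge (-C) (x - y))}

/-- The maximum `s`-breadth. -/
noncomputable def breadthMAX (s : E n) (K C : Set (E n)) : ℝ :=
  (supportFn K s + supportFn K (-s)) / max (supportFn C s) (supportFn C (-s))

/-- The diameter `D_M(K, C)`: the maximal `s`-length (for `MIN`, `HM`, `AM`) or `s`-breadth
(for `MAX`) over all directions `s ≠ 0`. -/
noncomputable def diameter : Mean → Set (E n) → Set (E n) → ℝ
  | Mean.MIN, K, C => ⨆ s : {s : E n // s ≠ 0}, lengthMIN s.1 K C
  | Mean.HM, K, C => ⨆ s : {s : E n // s ≠ 0}, lengthHM s.1 K C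
  | Mean.AM, K, C => ⨆ s : {s : E n // s ≠ 0}, lengthAM s.1 K C
  | Mean.MAX, K, C => ⨆ s : {s : E n // s ≠ 0}, breadthMAX s.1 K C

/-- `ρ` is the positive factor `ρ_M(C)`, for which `ρ C_M` is optimally contained in `C_AM`. -/
def IsRho (M : Mean) (C : Set (E n)) (ρ : ℝ) : Prop :=
  0 < ρ ∧ OptContained (ρ • symmetrization M C) (symmetrization Mean.AM C)

/-- `δ` is the positive factor `δ_M(C)`, for which `C_AM` is optimally contained in `δ C_M`. -/
def IsDelta (M : Mean) (C : Set (E n)) (δ : ℝ) : Prop :=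
  0 < δ ∧ OptContained (symmetrization Mean.AM C) (δ • symmetrization M C)

end GaugeGeometry

open GaugeGeometry

namespace GaugeGeometry

variable {n : ℕ}

/-! Everything reduces to inclusions between bodies symmetric about the origin. By
`diameter_le_iff`, `D_M(K, C) ≤ l` holds exactly when `K - K ⊆ l C_M`, for all four means. For
symmetric bodies an inclusion in a translate can be centred (`isLeast_circumradius`), so `ρ_M` and
`δ_M` are determined by least factors of inclusion between `C_M` and `C_AM`. This gives existence,
uniqueness and claim 1. Claims 2 and 3 compare `K - K` with `r (C - C) = 2r C_AM` when `t + r C ⊆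
K`, or `K ⊆ t + r C`.

Claims 4 and 5 rest on cancelling a compact convex summand (`mem_of_forall_add_mem`). Claim 4
follows from its `AM` case and claim 1. In that case, with `d = D_AM / 2`, `s = s(C)` and `t + r C ⊆
K`, each `x ∈ K` satisfies `x - t - r C ⊆ d C - d C ⊆ d C + (d - r) s C - r C`, and `-r C` cancels.
For claim 5, `symmetrization_subset_circumradius_smul` gives `C_M ⊆ R(C_M, C) C_MIN`, hence `K - K ⊆
m C_MIN` with `m = R(C_M, C) D_M`; cancelling `r C_MIN` leaves `K ⊆ t + (m - r) C`. -/

/-- A compact convex set with the origin in its interior. -/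
structure IsGaugeBody (B : Set (E n)) : Prop where
  convex : Convex ℝ B
  isCompact : IsCompact B
  zero_mem_interior : 0 ∈ interior B

/-! ### Gauge functions, separation and cancellation. -/

namespace IsGaugeBody

variable {B : Set (E n)}

theorem mem_nhds (hB : IsGaugeBody B) : B ∈ nhds (0 : E n) :=
  mem_interior_iff_mem_nhds.1 hB.zero_mem_interior

theorem zero_mem (hB : IsGaugeBody B) : (0 : E n) ∈ B :=
  interior_subset hB.zero_mem_interior

theorem absorbent (hB : IsGaugeBody B) : Absorbent ℝ B :=
  absorbent_nhds_zero hB.mem_nhds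

theorem isVonNBounded (hB : IsGaugeBody B) : Bornology.IsVonNBounded ℝ B :=
  (NormedSpace.isVonNBounded_iff ℝ).2 hB.isCompact.isBounded

theorem continuous_gauge (hB : IsGaugeBody B) : Continuous (gauge B) :=
  _root_.continuous_gauge hB.convex hB.mem_nhds

theorem gauge_pos_iff (hB : IsGaugeBody B) {x : E n} : 0 < gauge B x ↔ x ≠ 0 :=
  gauge_pos hB.absorbent hB.isVonNBounded

theorem gauge_add_le (hB : IsGaugeBody B) (x y : E n) :
    gauge B (x + y) ≤ gauge B x + gauge B y :=
  _root_.gauge_add_le hB.convex hB.absorbent x y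

theorem mem_iff (hB : IsGaugeBody B) {x : E n} : x ∈ B ↔ gauge B x ≤ 1 := by
  rw [gauge_le_one_iff_mem_closure hB.convex hB.mem_nhds, hB.isCompact.isClosed.closure_eq]

theorem mem_smul_iff (hB : IsGaugeBody B) {l : ℝ} (hl : 0 ≤ l) {x : E n} :
    x ∈ l • B ↔ gauge B x ≤ l := by
  refine ⟨gauge_le_of_mem hl, fun h => ?_⟩
  rcases hl.eq_or_lt with rfl | hl
  · have hx : x = 0 := by
      by_contra hx
      exact absurd (hB.gauge_pos_iff.2 hx) (not_lt.2 h)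
    exact ⟨0, hB.zero_mem, by simp [hx]⟩
  · rw [Set.mem_smul_set_iff_inv_smul_mem₀ hl.ne', hB.mem_iff,
      gauge_smul_of_nonneg (inv_nonneg.2 hl.le), smul_eq_mul, inv_mul_le_iff₀ hl, mul_one]
    exact h

theorem neg (hB : IsGaugeBody B) : IsGaugeBody (-B) where
  convex := hB.convex.neg
  isCompact := hB.isCompact.neg
  zero_mem_interior := by
    rw [mem_interior_iff_mem_nhds]
    exact neg_mem_nhds_zero _ hB.mem_nhds

end IsGaugeBody

/-- A gauge body that is symmetric about the origin. -/
structure IsSymmBody (B : Set (E n)) : Prop extends IsGaugeBody B where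
  neg_mem : ∀ x ∈ B, -x ∈ B

theorem gauge_eq_of_mem_smul_iff {B : Set (E n)} (hB : IsGaugeBody B) {x : E n} {a : ℝ}
    (ha : 0 ≤ a) (h : ∀ l : ℝ, 0 < l → (x ∈ l • B ↔ a ≤ l)) : gauge B x = a := by
  apply le_antisymm
  · refine le_of_forall_gt_imp_ge_of_dense fun l hl => ?_
    have hl0 : 0 < l := ha.trans_lt hl
    exact (hB.mem_smul_iff hl0.le).1 ((h l hl0).2 hl.le)
  · refine le_of_forall_gt_imp_ge_of_dense fun l hl => ?_
    have hl0 : 0 < l := (gauge_nonneg x).trans_lt hl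
    exact (h l hl0).1 ((hB.mem_smul_iff hl0.le).2 hl.le)

theorem exists_inner_lt_of_notMem {A : Set (E n)} (hA : Convex ℝ A) (hA' : IsClosed A) {x : E n}
    (hx : x ∉ A) : ∃ (a : E n) (u : ℝ), (∀ y ∈ A, inner ℝ a y < u) ∧ u < inner ℝ a x := by
  obtain ⟨f, u, h1, h2⟩ := geometric_hahn_banach_closed_point hA hA' hx
  refine ⟨(InnerProductSpace.toDual ℝ (E n)).symm f, u, fun y hy => ?_, ?_⟩
  · rw [InnerProductSpace.toDual_symm_apply]; exact h1 y hy
  · rw [InnerProductSpace.toDual_symm_apply]; exact h2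

/-- Cancellation of a nonempty compact summand. -/
theorem mem_of_forall_add_mem {A B : Set (E n)} (hA : Convex ℝ A) (hA' : IsClosed A)
    (hB : IsCompact B) (hB' : B.Nonempty) {x : E n}
    (h : ∀ b ∈ B, ∃ a ∈ A, ∃ b' ∈ B, x + b = a + b') : x ∈ A := by
  by_contra hx
  obtain ⟨f, u, h1, h2⟩ := exists_inner_lt_of_notMem hA hA' hx
  -- At a maximizer `b` of the separating functional, `x + b = a + b'` forces its value at `x` to be
  -- at most its value at `a`.
  obtain ⟨b, hb, hmax⟩ := hB.exists_isMaxOn hB' (f := fun y => inner ℝ f y) (by fun_prop)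
  obtain ⟨a, ha, b', hb', hab⟩ := h b hb
  have h3 : (inner ℝ f b' : ℝ) ≤ inner ℝ f b := hmax hb'
  have h4 := congrArg (fun y => (inner ℝ f y : ℝ)) hab
  simp only [inner_add_right] at h4
  linarith [h1 a ha]

/-! ### Circumradii and optimal containment of symmetric bodies. -/

section Circumradius

theorem circumradius_nonneg (K C : Set (E n)) : 0 ≤ circumradius K C :=
  Real.sInf_nonneg fun _ h => h.1

theorem circumradius_le {K C : Set (E n)} {r : ℝ} (hr : 0 ≤ r) (t : E n)
    (h : K ⊆ {t} + r • C) : circumradius K C ≤ r :=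
  csInf_le ⟨0, fun _ h => h.1⟩ ⟨hr, t, h⟩

theorem mem_singleton_add {t x : E n} {A : Set (E n)} : x ∈ {t} + A ↔ x - t ∈ A := by
  rw [Set.singleton_add, Set.image_add_left, Set.mem_preimage, neg_add_eq_sub]

theorem exists_circumradius_set {K C : Set (E n)} (hK : IsCompact K) (hC : IsGaugeBody C) :
    ∃ r : ℝ, 0 ≤ r ∧ K ⊆ r • C := by
  obtain ⟨r, hr⟩ := (hK.image hC.continuous_gauge).bddAbove
  refine ⟨max r 0, le_max_right _ _, fun x hx => ?_⟩
  rw [hC.mem_smul_iff (le_max_right _ _)]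
  exact (hr ⟨x, hx, rfl⟩).trans (le_max_left _ _)

theorem le_circumradius {K C : Set (E n)} (hK : IsCompact K) (hC : IsGaugeBody C) {r : ℝ}
    (h : ∀ l : ℝ, 0 ≤ l → ∀ t : E n, K ⊆ {t} + l • C → r ≤ l) : r ≤ circumradius K C := by
  refine le_csInf ?_ fun l hl => hl.2.elim (h l hl.1)
  obtain ⟨l, hl, hKl⟩ := exists_circumradius_set hK hC
  exact ⟨l, hl, 0, by simpa using hKl⟩

/-- Both `x - t` and `-x - t` lie in `r B`; by symmetry so does `x + t`, and `x` is the midpoint of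
`x - t` and `x + t`. -/
theorem subset_smul_of_subset_translate {A B : Set (E n)} (hA : ∀ x ∈ A, -x ∈ A)
    (hB : IsSymmBody B) {r : ℝ} (hr : 0 ≤ r) {t : E n} (h : A ⊆ {t} + r • B) : A ⊆ r • B := by
  intro x hx
  have h1 := (hB.mem_smul_iff hr).1 (mem_singleton_add.1 (h hx))
  have h2 := (hB.mem_smul_iff hr).1 (mem_singleton_add.1 (h (hA x hx)))
  rw [← gauge_neg hB.neg_mem] at h2
  rw [hB.mem_smul_iff hr]
  have h3 := hB.gauge_add_le (x - t) (-(-x - t))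
  have h4 : x - t + -(-x - t) = (2 : ℝ) • x := by module
  rw [h4, gauge_smul_of_nonneg (by norm_num), smul_eq_mul] at h3
  linarith

theorem isLeast_circumradius {A B : Set (E n)} (hA : IsCompact A) (hA' : ∀ x ∈ A, -x ∈ A)
    (hB : IsSymmBody B) : IsLeast {r : ℝ | 0 ≤ r ∧ A ⊆ r • B} (circumradius A B) := by
  refine ⟨⟨circumradius_nonneg _ _, fun x hx => ?_⟩, fun r hr =>
    circumradius_le hr.1 0 (by simpa using hr.2)⟩
  rw [hB.mem_smul_iff (circumradius_nonneg _ _)]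
  exact le_circumradius hA hB.toIsGaugeBody fun l hl t h =>
    gauge_le_of_mem hl (subset_smul_of_subset_translate hA' hB hl h hx)

theorem circumradius_pos [Nontrivial (E n)] {A B : Set (E n)} (hA : IsSymmBody A)
    (hB : IsSymmBody B) : 0 < circumradius A B := by
  refine (circumradius_nonneg _ _).lt_of_ne fun h => ?_
  obtain ⟨v, hv⟩ := exists_ne (0 : E n)
  have hg := hA.gauge_pos_iff.2 hv
  have h1 : (gauge A v)⁻¹ • v ∈ A := by
    rw [hA.mem_iff, gauge_smul_of_nonneg (inv_nonneg.2 hg.le), smul_eq_mul,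
      inv_mul_cancel₀ hg.ne']
  have h2 := (isLeast_circumradius hA.isCompact hA.neg_mem hB).1.2 h1
  rw [← h, hB.mem_smul_iff le_rfl] at h2
  have : (gauge A v)⁻¹ • v ≠ 0 := smul_ne_zero (inv_ne_zero hg.ne') hv
  exact absurd (hB.gauge_pos_iff.2 this) (not_lt.2 h2)

theorem le_of_smul_subset_smul [Nontrivial (E n)] {A : Set (E n)} (hA : IsGaugeBody A) {a b : ℝ}
    (hb : 0 ≤ b) (h : a • A ⊆ b • A) : a ≤ b := by
  rcases le_total a 0 with ha | ha
  · exact ha.trans hb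
  obtain ⟨v, hv⟩ := exists_ne (0 : E n)
  have hg := hA.gauge_pos_iff.2 hv
  have h1 : gauge A ((a * (gauge A v)⁻¹) • v) = a := by
    rw [gauge_smul_of_nonneg (by positivity), smul_eq_mul, inv_mul_cancel_right₀ hg.ne']
  have h2 := (hA.mem_smul_iff hb).1 (h ((hA.mem_smul_iff ha).2 h1.le))
  rwa [h1] at h2

theorem smul_subset_smul_mul {A B : Set (E n)} {a b c : ℝ} (h : A ⊆ b • B) (hc : c = a * b) :
    a • A ⊆ c • B := by
  rw [hc, mul_smul]
  exact Set.smul_set_mono h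

/-- Turns optimality into an equation for the factor, which yields existence and uniqueness of
`ρ_M`; the next lemma does the same for `δ_M`. -/
theorem optContained_smul_left_iff {A B : Set (E n)} (hA : IsSymmBody A)
    (hB : IsSymmBody B) {r : ℝ} (hr : 0 < r) :
    OptContained (r • A) B ↔ r * circumradius A B = 1 := by
  have hl := isLeast_circumradius hA.isCompact hA.neg_mem hB
  have hrA : IsCompact (r • A) := hA.isCompact.smul r
  have hrA' : ∀ x ∈ r • A, -x ∈ r • A := by
    rintro _ ⟨x, hx, rfl⟩
    exact ⟨-x, hA.neg_mem x hx, smul_neg _ _⟩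
  have hl' := isLeast_circumradius hrA hrA' hB
  have key : circumradius (r • A) B = r * circumradius A B := by
    apply le_antisymm
    · exact hl'.2 ⟨mul_nonneg hr.le hl.1.1, smul_subset_smul_mul hl.1.2 rfl⟩
    · rw [← le_inv_mul_iff₀ hr]
      refine hl.2 ⟨mul_nonneg (inv_nonneg.2 hr.le) hl'.1.1, ?_⟩
      have := smul_subset_smul_mul (a := r⁻¹) hl'.1.2 rfl
      rwa [inv_smul_smul₀ hr.ne'] at this
  rw [OptContained, key]
  refine ⟨And.right, fun h => ⟨?_, h⟩⟩
  have := hl'.1.2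
  rwa [key, h, one_smul] at this

theorem optContained_smul_right_iff {A B : Set (E n)} (hA : IsSymmBody A)
    (hB : IsSymmBody B) {r : ℝ} (hr : 0 < r) :
    OptContained A (r • B) ↔ r = circumradius A B := by
  have hl := isLeast_circumradius hA.isCompact hA.neg_mem hB
  have key : circumradius A (r • B) = r⁻¹ * circumradius A B := by
    apply le_antisymm
    · refine circumradius_le (mul_nonneg (inv_nonneg.2 hr.le) hl.1.1) 0 ?_
      rw [smul_smul, mul_right_comm, inv_mul_cancel₀ hr.ne', one_mul]
      simpa using hl.1.2
    · refine le_csInf ⟨r⁻¹ * circumradius A B, mul_nonneg (inv_nonneg.2 hr.le) hl.1.1, 0, ?_⟩ ?_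
      · rw [smul_smul, mul_right_comm, inv_mul_cancel₀ hr.ne', one_mul]
        simpa using hl.1.2
      · rintro l ⟨hl0, t, h⟩
        rw [inv_mul_le_iff₀ hr, mul_comm]
        rw [smul_smul] at h
        exact circumradius_le (mul_nonneg hl0 hr.le) t h
  rw [OptContained, key, inv_mul_eq_one₀ hr.ne']
  refine ⟨And.right, fun h => ⟨?_, h⟩⟩
  rw [h]
  exact hl.1.2

end Circumradius

theorem isCompact_sub {A B : Set (E n)} (hA : IsCompact A) (hB : IsCompact B) :
    IsCompact (A - B) := by
  rw [sub_eq_add_neg]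
  exact hA.add hB.neg

/-! ### The four symmetrizations and their gauges. -/

section Symmetrization

variable {C : Set (E n)}

theorem mem_symmetrization_AM {x : E n} :
    x ∈ symmetrization Mean.AM C ↔ ∃ c ∈ C, ∃ c' ∈ C, x = (1 / 2 : ℝ) • (c - c') := by
  constructor
  · rintro ⟨_, ⟨c, hc, c', hc', rfl⟩, rfl⟩
    exact ⟨c, hc, c', hc', rfl⟩
  · rintro ⟨c, hc, c', hc', rfl⟩
    exact ⟨_, ⟨c, hc, c', hc', rfl⟩, rfl⟩

theorem isSymmBody_min (hC : IsGaugeBody C) : IsSymmBody (symmetrization Mean.MIN C) where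
  convex := hC.convex.inter hC.neg.convex
  isCompact := hC.isCompact.inter hC.neg.isCompact
  zero_mem_interior := by
    rw [mem_interior_iff_mem_nhds]
    exact Filter.inter_mem hC.mem_nhds hC.neg.mem_nhds
  neg_mem x hx := ⟨hx.2, by simpa using hx.1⟩

theorem isSymmBody_am (hC : IsGaugeBody C) : IsSymmBody (symmetrization Mean.AM C) where
  convex := (hC.convex.sub hC.convex).smul _
  isCompact := (isCompact_sub hC.isCompact hC.isCompact).smul _
  zero_mem_interior := by
    rw [mem_interior_iff_mem_nhds]
    have h : (1 / 2 : ℝ) • C ∈ nhds (0 : E n) := by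
      have := (set_smul_mem_nhds_zero_iff (c := (1 / 2 : ℝ)) (by norm_num)).2 hC.mem_nhds
      exact this
    refine Filter.mem_of_superset h (Set.smul_set_mono fun c hc => ?_)
    exact ⟨c, hc, 0, hC.zero_mem, sub_zero c⟩
  neg_mem x hx := by
    obtain ⟨c, hc, c', hc', rfl⟩ := mem_symmetrization_AM.1 hx
    exact mem_symmetrization_AM.2 ⟨c', hc', c, hc, by module⟩

/-- Exhibits the convex hull as a continuous image of a compact set, for compactness. -/
theorem symmetrization_MAX_eq (hC : IsGaugeBody C) : symmetrization Mean.MAX C =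
    (fun p : ℝ × E n × E n => p.1 • p.2.1 + (1 - p.1) • p.2.2) ''
      (Set.Icc (0 : ℝ) 1 ×ˢ C ×ˢ (-C)) := by
  rw [symmetrization, hC.convex.convexHull_union hC.neg.convex ⟨0, hC.zero_mem⟩
    ⟨0, hC.neg.zero_mem⟩]
  ext x
  rw [mem_convexJoin]
  constructor
  · rintro ⟨a, ha, b, hb, p, q, hp, hq, hpq, rfl⟩
    refine ⟨(p, a, b), ⟨⟨hp, by linarith⟩, ha, hb⟩, ?_⟩
    simp only [← hpq, add_sub_cancel_left]
  · rintro ⟨⟨p, a, b⟩, ⟨⟨hp, hp'⟩, ha, hb⟩, rfl⟩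
    exact ⟨a, ha, b, hb, p, 1 - p, hp, sub_nonneg.2 hp', by ring, rfl⟩

theorem isSymmBody_max (hC : IsGaugeBody C) : IsSymmBody (symmetrization Mean.MAX C) where
  convex := convex_convexHull _ _
  isCompact := by
    rw [symmetrization_MAX_eq hC]
    exact (isCompact_Icc.prod (hC.isCompact.prod hC.neg.isCompact)).image (by fun_prop)
  zero_mem_interior := by
    rw [mem_interior_iff_mem_nhds]
    exact Filter.mem_of_superset hC.mem_nhds
      (Set.subset_union_left.trans (subset_convexHull ℝ _))
  neg_mem x hx := by
    have : -convexHull ℝ (C ∪ -C) = convexHull ℝ (C ∪ -C) := by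
      rw [← convexHull_neg, Set.union_neg, neg_neg, Set.union_comm]
    rw [symmetrization, ← this]
    exact Set.neg_mem_neg.2 hx

theorem inner_le_gauge (hC : IsGaugeBody C) {a : E n} (ha : a ∈ polarSet C) (x : E n) :
    inner ℝ a x ≤ gauge C x := by
  rcases eq_or_ne x 0 with rfl | hx
  · simp
  have hg := hC.gauge_pos_iff.2 hx
  have h1 : (gauge C x)⁻¹ • x ∈ C := by
    rw [hC.mem_iff, gauge_smul_of_nonneg (inv_nonneg.2 hg.le), smul_eq_mul,
      inv_mul_cancel₀ hg.ne']
  have h2 := ha _ h1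
  rwa [inner_smul_right, inv_mul_le_iff₀ hg, mul_one] at h2

/-- The bipolar theorem in gauge form: a functional separating `l⁻¹ x` from `C`, normalized by its
bound `u > 0` on `C`, lies in the polar and violates the hypothesis. -/
theorem gauge_le_of_forall_polar (hC : IsGaugeBody C) {x : E n} {m : ℝ}
    (h : ∀ a ∈ polarSet C, inner ℝ a x ≤ m) : gauge C x ≤ m := by
  have hm : 0 ≤ m := by simpa using h 0 (by simp [polarSet])
  refine le_of_forall_gt_imp_ge_of_dense fun l hl => ?_
  have hl0 : 0 < l := hm.trans_lt hl
  rw [← hC.mem_smul_iff hl0.le, Set.mem_smul_set_iff_inv_smul_mem₀ hl0.ne']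
  by_contra hx
  obtain ⟨a, u, h1, h2⟩ := exists_inner_lt_of_notMem hC.convex hC.isCompact.isClosed hx
  have hu : 0 < u := by simpa using h1 0 hC.zero_mem
  have h3 := h (u⁻¹ • a) fun y hy => by
    rw [real_inner_smul_left, inv_mul_le_iff₀ hu, mul_one]
    exact (h1 y hy).le
  rw [real_inner_smul_left, inv_mul_le_iff₀ hu] at h3
  rw [inner_smul_right, lt_inv_mul_iff₀ hl0] at h2
  nlinarith

/-- The two polar functionals vary independently, so the supremum of the sum splits into the two
gauges. -/
theorem mem_symmetrization_HM (hC : IsGaugeBody C) {x : E n} :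
    x ∈ symmetrization Mean.HM C ↔ gauge C x + gauge C (-x) ≤ 2 := by
  have h0 : x ∈ symmetrization Mean.HM C ↔
      ∀ a ∈ polarSet C, ∀ b ∈ polarSet C, (inner ℝ a x : ℝ) + inner ℝ b (-x) ≤ 2 := by
    constructor
    · intro h a ha b hb
      have := h _ ⟨_, ⟨a, ha, b, hb, rfl⟩, rfl⟩
      rw [inner_smul_right, inner_sub_right, real_inner_comm, real_inner_comm b] at this
      rw [inner_neg_right]
      linarith
    · rintro h _ ⟨_, ⟨a, ha, b, hb, rfl⟩, rfl⟩
      have := h a ha b hb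
      rw [inner_neg_right] at this
      change (inner ℝ x ((1 / 2 : ℝ) • (a - b)) : ℝ) ≤ 1
      rw [inner_smul_right, inner_sub_right, real_inner_comm, real_inner_comm b]
      linarith
  rw [h0]
  constructor
  · intro h
    have h1 : ∀ b ∈ polarSet C, gauge C x ≤ 2 - inner ℝ b (-x) := fun b hb =>
      gauge_le_of_forall_polar hC fun a ha => by linarith [h a ha b hb]
    have h2 : gauge C (-x) ≤ 2 - gauge C x :=
      gauge_le_of_forall_polar hC fun b hb => by linarith [h1 b hb]
    linarith
  · intro h a ha b hb
    linarith [inner_le_gauge hC ha x, inner_le_gauge hC hb (-x)]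

theorem isSymmBody_hm (hC : IsGaugeBody C) : IsSymmBody (symmetrization Mean.HM C) where
  convex x hx y hy a b ha hb hab := by
    rw [mem_symmetrization_HM hC] at *
    have h1 := hC.gauge_add_le (a • x) (b • y)
    have h2 := hC.gauge_add_le (a • -x) (b • -y)
    rw [gauge_smul_of_nonneg ha, gauge_smul_of_nonneg hb, smul_eq_mul, smul_eq_mul] at h1 h2
    have h3 : -(a • x + b • y) = a • -x + b • -y := by module
    rw [h3]
    have h4 := mul_le_mul_of_nonneg_left hx ha
    have h5 := mul_le_mul_of_nonneg_left hy hb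
    have h6 : b = 1 - a := by linarith
    subst h6
    linarith
  isCompact := by
    have hc := hC.continuous_gauge
    have hcl : IsClosed (symmetrization Mean.HM C) := by
      have : symmetrization Mean.HM C = {x | gauge C x + gauge C (-x) ≤ 2} :=
        Set.ext fun x => mem_symmetrization_HM hC
      rw [this]
      exact isClosed_le (hc.add (hc.comp continuous_neg)) continuous_const
    refine (hC.isCompact.smul (2 : ℝ)).of_isClosed_subset hcl fun x hx => ?_
    rw [mem_symmetrization_HM hC] at hx
    rw [hC.mem_smul_iff zero_le_two]
    linarith [gauge_nonneg (s := C) (-x)]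
  zero_mem_interior := by
    rw [mem_interior_iff_mem_nhds]
    refine Filter.mem_of_superset (Filter.inter_mem hC.mem_nhds hC.neg.mem_nhds) fun x hx => ?_
    rw [mem_symmetrization_HM hC]
    have h1 := hC.mem_iff.1 hx.1
    have h2 := hC.mem_iff.1 (Set.mem_neg.1 hx.2)
    linarith
  neg_mem x hx := by
    rw [mem_symmetrization_HM hC] at *
    rw [neg_neg]
    linarith

theorem isSymmBody_symmetrization (hC : IsGaugeBody C) :
    ∀ M : Mean, IsSymmBody (symmetrization M C)
  | Mean.MIN => isSymmBody_min hC
  | Mean.HM => isSymmBody_hm hC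
  | Mean.AM => isSymmBody_am hC
  | Mean.MAX => isSymmBody_max hC

theorem gauge_symmetrization_MIN (hC : IsGaugeBody C) (x : E n) :
    gauge (symmetrization Mean.MIN C) x = max (gauge C x) (gauge C (-x)) := by
  refine gauge_eq_of_mem_smul_iff (isSymmBody_min hC).toIsGaugeBody
    (le_max_of_le_left (gauge_nonneg _)) fun l hl => ?_
  rw [symmetrization, Set.smul_set_inter₀ hl.ne', Set.mem_inter_iff, hC.mem_smul_iff hl.le,
    hC.neg.mem_smul_iff hl.le, gauge_neg_set_eq_gauge_neg, max_le_iff]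

theorem gauge_symmetrization_HM (hC : IsGaugeBody C) (x : E n) :
    gauge (symmetrization Mean.HM C) x = (1 / 2) * (gauge C x + gauge (-C) x) := by
  refine gauge_eq_of_mem_smul_iff (isSymmBody_hm hC).toIsGaugeBody
    (mul_nonneg (by norm_num) (add_nonneg (gauge_nonneg _) (gauge_nonneg _))) fun l hl => ?_
  rw [Set.mem_smul_set_iff_inv_smul_mem₀ hl.ne', mem_symmetrization_HM hC, ← smul_neg,
    gauge_smul_of_nonneg (inv_nonneg.2 hl.le), gauge_smul_of_nonneg (inv_nonneg.2 hl.le),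
    gauge_neg_set_eq_gauge_neg, ← smul_add, smul_eq_mul, inv_mul_le_iff₀ hl]
  constructor <;> intro h <;> linarith

/-- A segment fits into a translate of `l C` exactly when the difference of its endpoints lies in `l
(C - C) = 2l C_AM`. -/
theorem two_mul_circumradius_segment (hC : IsGaugeBody C) (x y : E n) :
    2 * circumradius (segment ℝ x y) C = gauge (symmetrization Mean.AM C) (x - y) := by
  have hA := isSymmBody_am hC
  set g := gauge (symmetrization Mean.AM C) (x - y) with hg
  have hg0 : 0 ≤ g := gauge_nonneg _
  have hseg : IsCompact (segment ℝ x y) := by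
    rw [segment_eq_image]
    exact isCompact_Icc.image (by fun_prop)
  apply le_antisymm
  · obtain ⟨_, hz, hxy⟩ := (hA.mem_smul_iff hg0).2 hg.ge
    obtain ⟨c, hc, c', hc', rfl⟩ := mem_symmetrization_AM.1 hz
    have h1 : x - y = (g / 2) • (c - c') := by
      rw [← hxy]
      simp only
      module
    have h2 : circumradius (segment ℝ x y) C ≤ g / 2 := by
      -- This translation puts `x` at `(g / 2) c` and `y` at `(g / 2) c'`.
      refine circumradius_le (by positivity) (x - (g / 2) • c)
        (((convex_singleton _).add (hC.convex.smul _)).segment_subset ?_ ?_)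
      · exact mem_singleton_add.2 ⟨c, hc, by module⟩
      · refine mem_singleton_add.2 ⟨c', hc', ?_⟩
        have : y = x - (g / 2) • (c - c') := by rw [← h1]; abel
        rw [this]
        module
    linarith
  · suffices g / 2 ≤ circumradius (segment ℝ x y) C by linarith
    refine le_circumradius hseg hC fun l hl t h => ?_
    obtain ⟨c, hc, hx⟩ := mem_singleton_add.1 (h (left_mem_segment ℝ x y))
    obtain ⟨c', hc', hy⟩ := mem_singleton_add.1 (h (right_mem_segment ℝ x y))
    have h1 : x - y ∈ (2 * l) • symmetrization Mean.AM C := by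
      refine ⟨_, mem_symmetrization_AM.2 ⟨c, hc, c', hc', rfl⟩, ?_⟩
      have : x - y = (x - t) - (y - t) := by abel
      rw [this, ← hx, ← hy]
      simp only
      module
    have := gauge_le_of_mem (by positivity) h1
    linarith

end Symmetrization

/-! ### Support functions. -/

section Support

variable {C : Set (E n)}

theorem inner_le_supportFn (hC : IsCompact C) {x : E n} (hx : x ∈ C) (a : E n) :
    inner ℝ a x ≤ supportFn C a :=
  le_csSup (hC.image (f := fun x => inner ℝ a x) (by fun_prop)).bddAbove ⟨x, hx, rfl⟩

theorem exists_inner_eq_supportFn (hC : IsCompact C) (hC' : C.Nonempty) (a : E n) :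
    ∃ x ∈ C, inner ℝ a x = supportFn C a :=
  (hC.image (f := fun x => inner ℝ a x) (by fun_prop)).sSup_mem (hC'.image _)

theorem supportFn_pos (hC : IsGaugeBody C) {a : E n} (ha : a ≠ 0) : 0 < supportFn C a := by
  have h1 := hC.gauge_pos_iff.2 ha
  have h2 : (gauge C a)⁻¹ • a ∈ C := by
    rw [hC.mem_iff, gauge_smul_of_nonneg (inv_nonneg.2 h1.le), smul_eq_mul,
      inv_mul_cancel₀ h1.ne']
  refine lt_of_lt_of_le ?_ (inner_le_supportFn hC.isCompact h2 a)
  rw [inner_smul_right]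
  exact mul_pos (inv_pos.2 h1) (real_inner_self_pos.2 ha)

theorem inner_le_of_mem_symmetrization_MAX (hC : IsGaugeBody C) {x : E n}
    (hx : x ∈ symmetrization Mean.MAX C) (a : E n) :
    inner ℝ a x ≤ max (supportFn C a) (supportFn C (-a)) := by
  have hconv : Convex ℝ {y : E n | inner ℝ a y ≤ max (supportFn C a) (supportFn C (-a))} :=
    convex_halfSpace_le (f := fun y => (inner ℝ a y : ℝ))
      ⟨fun x y => inner_add_right _ _ _, fun c x => inner_smul_right _ _ _⟩ _
  refine convexHull_min (Set.union_subset ?_ ?_) hconv hx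
  · exact fun y hy => (inner_le_supportFn hC.isCompact hy a).trans (le_max_left _ _)
  · intro y hy
    have := inner_le_supportFn hC.isCompact (Set.mem_neg.1 hy) (-a)
    rw [inner_neg_neg] at this
    exact this.trans (le_max_right _ _)

end Support

/-! ### Diameters as inclusions of `K - K`. -/

section Diameter

variable {K C : Set (E n)}

theorem iSup_length_le_iff [Nontrivial (E n)] (hK : IsCompact K) {g : E n → ℝ}
    (hg : Continuous g) (hg0 : g 0 = 0) {l : ℝ} (hl : 0 ≤ l) :
    (⨆ s : {s : E n // s ≠ 0}, sSup {d : ℝ | ∃ x ∈ K, ∃ y ∈ K,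
      x - y ∈ Submodule.span ℝ {s.1} ∧ d = g (x - y)}) ≤ l ↔
    ∀ x ∈ K, ∀ y ∈ K, g (x - y) ≤ l := by
  have key : ∀ m : ℝ, 0 ≤ m → (∀ x ∈ K, ∀ y ∈ K, g (x - y) ≤ m) → ∀ s : {s : E n // s ≠ 0},
      sSup {d : ℝ | ∃ x ∈ K, ∃ y ∈ K, x - y ∈ Submodule.span ℝ {s.1} ∧ d = g (x - y)} ≤ m := by
    intro m hm h s
    refine Real.sSup_le ?_ hm
    rintro _ ⟨x, hx, y, hy, -, rfl⟩
    exact h x hx y hy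
  refine ⟨fun h x hx y hy => ?_, fun h => Real.iSup_le (key l hl h) hl⟩
  -- A real supremum bounds its members only if the set is bounded above (otherwise it is `0` by
  -- default); compactness of `K - K` supplies a bound common to all directions.
  obtain ⟨m, hm⟩ := ((isCompact_sub hK hK).image hg).bddAbove
  have hm' : ∀ x ∈ K, ∀ y ∈ K, g (x - y) ≤ max m 0 := fun x hx y hy =>
    (hm ⟨_, ⟨x, hx, y, hy, rfl⟩, rfl⟩).trans (le_max_left _ _)
  rcases eq_or_ne (x - y) 0 with hxy | hxy
  · rw [hxy, hg0]
    exact hl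
  refine le_trans ?_ ((le_ciSup ⟨max m 0, ?_⟩ ⟨x - y, hxy⟩).trans h)
  · refine le_csSup ⟨max m 0, ?_⟩ ⟨x, hx, y, hy, Submodule.mem_span_singleton_self _, rfl⟩
    rintro _ ⟨x, hx, y, hy, -, rfl⟩
    exact hm' x hx y hy
  · rintro _ ⟨s, rfl⟩
    exact key _ (le_max_right _ _) hm' s

theorem breadthMAX_le (hK : IsCompact K) (hK' : K.Nonempty) (hC : IsGaugeBody C) {l : ℝ}
    (hl : 0 ≤ l) (h : ∀ x ∈ K, ∀ y ∈ K, x - y ∈ l • symmetrization Mean.MAX C) {s : E n}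
    (hs : s ≠ 0) : breadthMAX s K C ≤ l := by
  have hpos : 0 < max (supportFn C s) (supportFn C (-s)) :=
    lt_max_of_lt_left (supportFn_pos hC hs)
  rw [breadthMAX, div_le_iff₀ hpos]
  obtain ⟨x, hx, hx'⟩ := exists_inner_eq_supportFn hK hK' s
  obtain ⟨y, hy, hy'⟩ := exists_inner_eq_supportFn hK hK' (-s)
  obtain ⟨z, hz, hxy⟩ := h x hx y hy
  have h1 := inner_le_of_mem_symmetrization_MAX hC hz s
  have h2 := congrArg (fun v => (inner ℝ s v : ℝ)) hxy
  simp only [inner_smul_right, inner_sub_right] at h2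
  rw [← hx', ← hy', inner_neg_left]
  have h3 := mul_le_mul_of_nonneg_left h1 hl
  linarith

/-- The support function of `C_MAX` is the denominator of the breadth, so a functional separating `x
- y` from `l C_MAX` would be a direction of breadth exceeding `l`. -/
theorem mem_smul_MAX_of_breadthMAX_le (hK : IsCompact K) (hC : IsGaugeBody C) {l : ℝ}
    (hl : 0 ≤ l) (h : ∀ s : E n, s ≠ 0 → breadthMAX s K C ≤ l) {x y : E n} (hx : x ∈ K)
    (hy : y ∈ K) : x - y ∈ l • symmetrization Mean.MAX C := by
  have hM := isSymmBody_max hC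
  by_contra hxy
  obtain ⟨a, u, h1, h2⟩ := exists_inner_lt_of_notMem (hM.convex.smul l)
    (hM.isCompact.smul l).isClosed hxy
  have hu : 0 < u := by simpa using h1 0 ⟨0, hM.zero_mem, smul_zero _⟩
  have ha : a ≠ 0 := by
    rintro rfl
    simp only [inner_zero_left] at h2
    linarith
  have hpos : 0 < max (supportFn C a) (supportFn C (-a)) :=
    lt_max_of_lt_left (supportFn_pos hC ha)
  have h3 := h a ha
  rw [breadthMAX, div_le_iff₀ hpos] at h3
  have h4 : l * max (supportFn C a) (supportFn C (-a)) ≤ u := by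
    rw [mul_max_of_nonneg _ _ hl]
    apply max_le
    · obtain ⟨c, hc, hc'⟩ := exists_inner_eq_supportFn hC.isCompact ⟨0, hC.zero_mem⟩ a
      have := h1 (l • c) ⟨c, subset_convexHull ℝ _ (Or.inl hc), rfl⟩
      rw [inner_smul_right, hc'] at this
      exact this.le
    · obtain ⟨c, hc, hc'⟩ := exists_inner_eq_supportFn hC.isCompact ⟨0, hC.zero_mem⟩ (-a)
      have := h1 (l • -c) ⟨-c, subset_convexHull ℝ _ (Or.inr (by simpa using hc)), rfl⟩
      rw [inner_smul_right, inner_neg_right, ← inner_neg_left, hc'] at this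
      exact this.le
  have h5 := inner_le_supportFn hK hx a
  have h6 := inner_le_supportFn hK hy (-a)
  rw [inner_neg_left] at h6
  rw [inner_sub_right] at h2
  linarith

theorem diameter_le_iff [Nontrivial (E n)] (hK : IsCompact K) (hK' : K.Nonempty)
    (hC : IsGaugeBody C) (M : Mean) {l : ℝ} (hl : 0 ≤ l) :
    diameter M K C ≤ l ↔ ∀ x ∈ K, ∀ y ∈ K, x - y ∈ l • symmetrization M C := by
  have hM := isSymmBody_symmetrization hC M
  have hgauge : (∀ x ∈ K, ∀ y ∈ K, x - y ∈ l • symmetrization M C) ↔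
      ∀ x ∈ K, ∀ y ∈ K, gauge (symmetrization M C) (x - y) ≤ l := by
    simp only [hM.mem_smul_iff hl]
  cases M with
  | MIN =>
    rw [hgauge, diameter]
    refine (iSup_length_le_iff hK hC.continuous_gauge gauge_zero hl).trans ?_
    -- The one-sided gauge suffices, since `x` and `y` may be swapped.
    simp only [gauge_symmetrization_MIN hC, max_le_iff, neg_sub]
    exact ⟨fun h x hx y hy => ⟨h x hx y hy, h y hy x hx⟩, fun h x hx y hy => (h x hx y hy).1⟩
  | HM =>
    rw [hgauge, diameter]
    simp only [gauge_symmetrization_HM hC]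
    exact iSup_length_le_iff hK
      (g := fun v => (1 / 2) * (gauge C v + gauge (-C) v))
      (continuous_const.mul (hC.continuous_gauge.add hC.neg.continuous_gauge))
      (by simp [gauge_zero]) hl
  | AM =>
    rw [hgauge, diameter]
    simp only [lengthAM, two_mul_circumradius_segment hC]
    exact iSup_length_le_iff hK hM.continuous_gauge gauge_zero hl
  | MAX =>
    refine ⟨fun h x hx y hy => ?_, fun h => Real.iSup_le
      (fun s => breadthMAX_le hK hK' hC hl h s.2) hl⟩
    refine mem_smul_MAX_of_breadthMAX_le hK hC hl (fun s hs => ?_) hx hy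
    obtain ⟨m, hm, hKm⟩ := exists_circumradius_set (isCompact_sub hK hK) hM.toIsGaugeBody
    refine (le_ciSup (f := fun s : {s : E n // s ≠ 0} => breadthMAX s.1 K C) ⟨m, ?_⟩
      ⟨s, hs⟩).trans h
    rintro _ ⟨s, rfl⟩
    exact breadthMAX_le hK hK' hC hm (fun x hx y hy => hKm ⟨x, hx, y, hy, rfl⟩) s.2

theorem breadthMAX_nonneg (hK : IsCompact K) (hK' : K.Nonempty) (hC : IsGaugeBody C) {s : E n}
    (hs : s ≠ 0) : 0 ≤ breadthMAX s K C := by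
  obtain ⟨x, hx⟩ := hK'
  have h1 := inner_le_supportFn hK hx s
  have h2 := inner_le_supportFn hK hx (-s)
  rw [inner_neg_left] at h2
  exact div_nonneg (by linarith) (le_max_of_le_left (supportFn_pos hC hs).le)

theorem diameter_nonneg (hK : IsCompact K) (hK' : K.Nonempty)
    (hC : IsGaugeBody C) (M : Mean) : 0 ≤ diameter M K C := by
  cases M with
  | MIN =>
    refine Real.iSup_nonneg fun s => Real.sSup_nonneg ?_
    rintro _ ⟨x, -, y, -, -, rfl⟩
    exact gauge_nonneg _
  | HM =>
    refine Real.iSup_nonneg fun s => Real.sSup_nonneg ?_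
    rintro _ ⟨x, -, y, -, -, rfl⟩
    exact mul_nonneg (by norm_num) (add_nonneg (gauge_nonneg _) (gauge_nonneg _))
  | AM =>
    refine Real.iSup_nonneg fun s => Real.sSup_nonneg ?_
    rintro _ ⟨x, -, y, -, -, rfl⟩
    exact mul_nonneg zero_le_two (circumradius_nonneg _ _)
  | MAX => exact Real.iSup_nonneg fun s => breadthMAX_nonneg hK hK' hC s.2

theorem sub_mem_diameter_smul [Nontrivial (E n)] (hK : IsCompact K) (hK' : K.Nonempty)
    (hC : IsGaugeBody C) (M : Mean) {x y : E n} (hx : x ∈ K) (hy : y ∈ K) :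
    x - y ∈ diameter M K C • symmetrization M C :=
  (diameter_le_iff hK hK' hC M (diameter_nonneg hK hK' hC M)).1 le_rfl x hx y hy

end Diameter

/-! ### Minkowski-centered gauges. -/

section Centered

variable {C : Set (E n)}

theorem asymmetry_le_of_neg_mem {l : ℝ} (hl : 0 ≤ l) (t : E n)
    (h : ∀ c ∈ C, -c - t ∈ l • C) : asymmetry C ≤ l := by
  refine circumradius_le hl (-t) fun c hc => mem_singleton_add.2 ?_
  obtain ⟨c', hc', hcc⟩ := h c hc
  refine ⟨-c', Set.neg_mem_neg.2 hc', ?_⟩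
  simp only at hcc ⊢
  rw [smul_neg, hcc]
  abel

theorem neg_mem_asymmetry_smul (hC' : MinkowskiCentered C) {c : E n} (hc : c ∈ C) :
    -c ∈ asymmetry C • C := by
  obtain ⟨c', hc', rfl⟩ := hC'.1 hc
  exact ⟨c', hc', by module⟩

theorem gauge_neg_le (hC : IsGaugeBody C) (hC' : MinkowskiCentered C) (x : E n) :
    gauge C (-x) ≤ asymmetry C * gauge C x := by
  have hs : 0 ≤ asymmetry C := circumradius_nonneg _ _
  obtain ⟨c, hc, hx⟩ := (hC.mem_smul_iff (gauge_nonneg x)).2 le_rfl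
  have h1 := (hC.mem_smul_iff hs).1 (neg_mem_asymmetry_smul hC' hc)
  have h2 : gauge C (-x) = gauge C x * gauge C (-c) := by
    conv_lhs => rw [← hx]
    simp only
    rw [← smul_neg, gauge_smul_of_nonneg (gauge_nonneg x), smul_eq_mul]
  rw [h2, mul_comm (asymmetry C)]
  exact mul_le_mul_of_nonneg_left h1 (gauge_nonneg x)

theorem one_le_asymmetry [Nontrivial (E n)] (hC : IsGaugeBody C) (hC' : MinkowskiCentered C) :
    1 ≤ asymmetry C := by
  have hs : 0 ≤ asymmetry C := circumradius_nonneg _ _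
  obtain ⟨v, hv⟩ := exists_ne (0 : E n)
  have hg := hC.gauge_pos_iff.2 hv
  have h1 := gauge_neg_le hC hC' v
  have h2 := gauge_neg_le hC hC' (-v)
  rw [neg_neg] at h2
  by_contra h
  push Not at h
  nlinarith [gauge_nonneg (s := C) (-v)]

/-- If `B ⊆ t + m C`, then `-(l / s) C ⊆ B` puts `-C` into a translate of `(s m / l) C`; by
definition of the asymmetry `s ≤ s m / l`, so `l ≤ m`. -/
theorem circumradius_eq_of_sandwich (hC : IsGaugeBody C) {B : Set (E n)} {l : ℝ} (hl : 0 < l)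
    (hs : 0 < asymmetry C) (hB : IsCompact B) (h1 : ∀ c ∈ C, (l / asymmetry C) • -c ∈ B)
    (h2 : B ⊆ l • C) : circumradius B C = l := by
  apply le_antisymm
  · exact circumradius_le hl.le 0 (by simpa using h2)
  · refine le_circumradius hB hC fun m hm t hBm => ?_
    have h3 : asymmetry C ≤ asymmetry C / l * m := by
      refine asymmetry_le_of_neg_mem (by positivity) ((asymmetry C / l) • t) fun c hc => ?_
      obtain ⟨c', hc', h4⟩ := mem_singleton_add.1 (hBm (h1 c hc))
      refine ⟨c', hc', ?_⟩
      simp only at h4 ⊢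
      rw [mul_smul, h4, smul_sub, smul_smul, div_mul_div_cancel₀ hl.ne', div_self hs.ne',
        one_smul]
    rwa [div_mul_eq_mul_div, le_div_iff₀ hl, mul_le_mul_iff_right₀ hs] at h3

/-- For a Minkowski-centered gauge, the circumradius of each symmetrization is attained by a
multiple of the gauge that is not translated. -/
theorem symmetrization_subset_circumradius_smul [Nontrivial (E n)] (hC : IsGaugeBody C)
    (hC' : MinkowskiCentered C) (M : Mean) :
    symmetrization M C ⊆ circumradius (symmetrization M C) C • C := by
  have hs1 := one_le_asymmetry hC hC'
  have hneg := fun x => gauge_neg_le hC hC' x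
  set s := asymmetry C with hs
  have hs0 : 0 < s := by linarith
  have hM := isSymmBody_symmetrization hC M
  -- It remains to sandwich `C_M` between `-(l / s) C` and `l C`. The factors are `1`, `2s / (s +
  -- 1)`, `(s + 1) / 2` and `s` for `MIN`, `HM`, `AM` and `MAX`.
  suffices ∃ l : ℝ, 0 < l ∧ (∀ c ∈ C, (l / s) • -c ∈ symmetrization M C) ∧
      symmetrization M C ⊆ l • C by
    obtain ⟨l, hl, h1, h2⟩ := this
    rwa [circumradius_eq_of_sandwich hC hl hs0 hM.isCompact h1 h2]
  cases M with
  | MIN =>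
    refine ⟨1, one_pos, fun c hc => ?_, fun x hx => by simpa using hx.1⟩
    have h1 := hC.mem_iff.1 hc
    have h2 := hneg c
    rw [hM.mem_iff, gauge_symmetrization_MIN hC, ← smul_neg, neg_neg,
      gauge_smul_of_nonneg (by positivity), gauge_smul_of_nonneg (by positivity), smul_eq_mul,
      smul_eq_mul, max_le_iff, div_mul_eq_mul_div, div_mul_eq_mul_div, div_le_one hs0,
      div_le_one hs0]
    constructor <;> nlinarith
  | HM =>
    refine ⟨2 * s / (s + 1), by positivity, fun c hc => ?_, fun x hx => ?_⟩
    · have h1 := hC.mem_iff.1 hc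
      have h2 := hneg c
      have h3 : 2 * s / (s + 1) / s = 2 / (s + 1) := by field_simp
      rw [mem_symmetrization_HM hC, h3, ← smul_neg, neg_neg,
        gauge_smul_of_nonneg (by positivity), gauge_smul_of_nonneg (by positivity), ← smul_add,
        smul_eq_mul, div_mul_eq_mul_div, div_le_iff₀ (by positivity)]
      nlinarith
    · rw [mem_symmetrization_HM hC] at hx
      rw [hC.mem_smul_iff (by positivity), le_div_iff₀ (by positivity)]
      -- From `gauge C x ≤ s * gauge C (-x)` and a sum of gauges at most `2` comes `gauge C x ≤ 2s /
      -- (s + 1)`.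
      have h2 := hneg (-x)
      rw [neg_neg] at h2
      nlinarith
  | AM =>
    have h3 : ∀ c ∈ C, s⁻¹ • -c ∈ C := fun c hc => by
      rw [← Set.mem_smul_set_iff_inv_smul_mem₀ hs0.ne']
      exact neg_mem_asymmetry_smul hC' hc
    refine ⟨(s + 1) / 2, by positivity, fun c hc => ?_, fun x hx => ?_⟩
    · refine mem_symmetrization_AM.2 ⟨_, h3 c hc, c, hc, ?_⟩
      have h4 : (s + 1) / 2 / s = (1 / 2) * (1 + s⁻¹) := by field_simp
      rw [h4]
      module
    · obtain ⟨c, hc, c', hc', rfl⟩ := mem_symmetrization_AM.1 hx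
      have h4 := hC.gauge_add_le c (-c')
      have h5 := hC.mem_iff.1 hc
      have h6 := hC.mem_iff.1 hc'
      have h7 := hneg c'
      rw [hC.mem_smul_iff (by positivity), gauge_smul_of_nonneg (by norm_num), smul_eq_mul,
        sub_eq_add_neg]
      nlinarith
  | MAX =>
    refine ⟨s, hs0, fun c hc => ?_, convexHull_min (Set.union_subset (fun c hc => ?_)
      fun c hc => ?_) (hC.convex.smul s)⟩
    · rw [div_self hs0.ne', one_smul]
      exact subset_convexHull ℝ _ (Or.inr (Set.neg_mem_neg.2 hc))
    · rw [hC.mem_smul_iff hs0.le]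
      exact (hC.mem_iff.1 hc).trans hs1
    · simpa using neg_mem_asymmetry_smul hC' (Set.mem_neg.1 hc)

end Centered

/-! ### The inequalities between inradius, circumradius and diameter. -/

section Radii

variable {K C : Set (E n)}

theorem inradius_le (hK' : K.Nonempty) {m : ℝ} (hC : C.Nonempty)
    (h : ∀ r : ℝ, 0 ≤ r → ∀ t : E n, {t} + r • C ⊆ K → r ≤ m) : inradius K C ≤ m := by
  refine csSup_le ?_ fun r hr => hr.2.elim (h r hr.1)
  obtain ⟨x, hx⟩ := hK'
  exact ⟨0, le_rfl, x, by simpa [Set.zero_smul_set hC] using hx⟩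

theorem add_smul_mem_of_translate_subset {r : ℝ} {t c : E n} (h : {t} + r • C ⊆ K) (hc : c ∈ C) :
    t + r • c ∈ K :=
  h (Set.add_mem_add rfl (Set.smul_mem_smul_set hc))

theorem two_mul_smul_AM_subset [Nontrivial (E n)] (hK : IsCompact K) (hK' : K.Nonempty)
    (hC : IsGaugeBody C) (M : Mean) {r : ℝ} {t : E n} (h : {t} + r • C ⊆ K) :
    (2 * r) • symmetrization Mean.AM C ⊆ diameter M K C • symmetrization M C := by
  rintro _ ⟨_, hz, rfl⟩
  obtain ⟨c, hc, c', hc', rfl⟩ := mem_symmetrization_AM.1 hz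
  have h1 := sub_mem_diameter_smul hK hK' hC M (add_smul_mem_of_translate_subset h hc)
    (add_smul_mem_of_translate_subset h hc')
  have h2 : t + r • c - (t + r • c') = (2 * r) • (1 / 2 : ℝ) • (c - c') := by module
  rwa [h2] at h1

theorem two_mul_le_diameter_AM [Nontrivial (E n)] (hK : IsCompact K) (hK' : K.Nonempty)
    (hC : IsGaugeBody C) {r : ℝ} {t : E n} (h : {t} + r • C ⊆ K) :
    2 * r ≤ diameter Mean.AM K C :=
  le_of_smul_subset_smul (isSymmBody_am hC).toIsGaugeBody (diameter_nonneg hK hK' hC _)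
    (two_mul_smul_AM_subset hK hK' hC Mean.AM h)

theorem mul_diameter_AM_le [Nontrivial (E n)] (hK : IsCompact K) (hK' : K.Nonempty)
    (hC : IsGaugeBody C) (M : Mean) {r : ℝ} (hr : 0 < r)
    (h : r • symmetrization M C ⊆ symmetrization Mean.AM C) :
    r * diameter Mean.AM K C ≤ diameter M K C := by
  have hD := diameter_nonneg hK hK' hC M
  rw [← le_inv_mul_iff₀ hr, diameter_le_iff hK hK' hC _ (by positivity)]
  intro x hx y hy
  obtain ⟨z, hz, hxy⟩ := sub_mem_diameter_smul hK hK' hC M hx hy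
  refine ⟨r • z, h (Set.smul_mem_smul_set hz), ?_⟩
  rw [← hxy]
  simp only
  rw [smul_smul, mul_right_comm, inv_mul_cancel₀ hr.ne', one_mul]

theorem diameter_le_mul_diameter_AM [Nontrivial (E n)] (hK : IsCompact K) (hK' : K.Nonempty)
    (hC : IsGaugeBody C) (M : Mean) {d : ℝ} (hd : 0 < d)
    (h : symmetrization Mean.AM C ⊆ d • symmetrization M C) :
    diameter M K C ≤ d * diameter Mean.AM K C := by
  have hD := diameter_nonneg hK hK' hC Mean.AM
  rw [diameter_le_iff hK hK' hC _ (by positivity)]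
  intro x hx y hy
  exact smul_subset_smul_mul h (mul_comm _ _) (sub_mem_diameter_smul hK hK' hC Mean.AM hx hy)

theorem mul_inradius_le [Nontrivial (E n)] (hK : IsCompact K) (hK' : K.Nonempty)
    (hC : IsGaugeBody C) (M : Mean) {d : ℝ} (hd : IsDelta M C d) :
    d * inradius K C ≤ diameter M K C / 2 := by
  have hD := diameter_nonneg hK hK' hC M
  rw [← le_inv_mul_iff₀ hd.1]
  refine inradius_le hK' ⟨0, hC.zero_mem⟩ fun r hr t h => ?_
  rw [le_inv_mul_iff₀ hd.1]
  -- The case `r = 0` is separate because the inclusion is next divided by `2 * r`.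
  rcases hr.eq_or_lt with rfl | hr
  · simpa using by positivity
  have h1 := smul_subset_smul_mul (a := (2 * r)⁻¹) (two_mul_smul_AM_subset hK hK' hC M h) rfl
  rw [inv_smul_smul₀ (by positivity)] at h1
  have hl := isLeast_circumradius (isSymmBody_am hC).isCompact (isSymmBody_am hC).neg_mem
    (isSymmBody_symmetrization hC M)
  rw [(optContained_smul_right_iff (isSymmBody_am hC) (isSymmBody_symmetrization hC M) hd.1).1 hd.2]
  have h2 := hl.2 ⟨by positivity, h1⟩
  rw [le_inv_mul_iff₀ (by positivity)] at h2
  linarith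

theorem diameter_le_mul_circumradius [Nontrivial (E n)] (hK : IsCompact K) (hK' : K.Nonempty)
    (hC : IsGaugeBody C) (M : Mean) {d : ℝ} (hd : 0 < d)
    (h : symmetrization Mean.AM C ⊆ d • symmetrization M C) :
    diameter M K C / 2 ≤ d * circumradius K C := by
  rw [← inv_mul_le_iff₀ hd]
  refine le_circumradius hK hC fun l hl t hKl => ?_
  rw [inv_mul_le_iff₀ hd, div_le_iff₀ two_pos,
    diameter_le_iff hK hK' hC _ (by positivity)]
  intro x hx y hy
  obtain ⟨c, hc, hcx⟩ := mem_singleton_add.1 (hKl hx)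
  obtain ⟨c', hc', hcy⟩ := mem_singleton_add.1 (hKl hy)
  refine smul_subset_smul_mul (a := 2 * l) h (by ring)
    ⟨_, mem_symmetrization_AM.2 ⟨c, hc, c', hc', rfl⟩, ?_⟩
  have : x - y = (x - t) - (y - t) := by abel
  rw [this, ← hcx, ← hcy]
  simp only
  module

theorem asymmetry_mul_inradius_add_circumradius_le [Nontrivial (E n)] (hK : IsCompact K)
    (hK' : K.Nonempty) (hC : IsGaugeBody C) (hC' : MinkowskiCentered C) :
    asymmetry C * inradius K C + circumradius K C ≤
      (asymmetry C + 1) * (diameter Mean.AM K C / 2) := by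
  have hs1 := one_le_asymmetry hC hC'
  have hs0 : 0 < asymmetry C := by linarith
  rw [← le_sub_iff_add_le, ← le_inv_mul_iff₀ hs0]
  refine inradius_le hK' ⟨0, hC.zero_mem⟩ fun r hr t h => ?_
  rw [le_inv_mul_iff₀ hs0, le_sub_comm]
  have hr2 := two_mul_le_diameter_AM hK hK' hC h
  set d := diameter Mean.AM K C / 2 with hd
  have hrd : 0 ≤ d - r := by linarith
  have hd0 : 0 ≤ d := by linarith
  have hl : 0 ≤ d + (d - r) * asymmetry C := by positivity
  have key : circumradius K C ≤ d + (d - r) * asymmetry C := by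
    refine circumradius_le hl t fun x hx => mem_singleton_add.2 ?_
    refine mem_of_forall_add_mem (B := (-r) • C) (hC.convex.smul _)
      (hC.isCompact.smul _).isClosed (hC.isCompact.smul _) ⟨_, 0, hC.zero_mem, rfl⟩ ?_
    rintro _ ⟨c, hc, rfl⟩
    obtain ⟨_, hz, hxc⟩ := sub_mem_diameter_smul hK hK' hC Mean.AM hx
      (add_smul_mem_of_translate_subset h hc)
    obtain ⟨p, hp, q, hq, rfl⟩ := mem_symmetrization_AM.1 hz
    obtain ⟨q', hq', hqq⟩ := neg_mem_asymmetry_smul hC' hq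
    -- Splits `d (p - q)` as `d p + (d - r)(-q) + (-r) q`: the last term is the one to cancel, and
    -- `-q ∈ s C` absorbs the middle one.
    refine ⟨d • p + (d - r) • -q, ?_, (-r) • q, ⟨q, hq, rfl⟩, ?_⟩
    · rw [hC.convex.add_smul hd0 (by positivity)]
      refine Set.add_mem_add ⟨p, hp, rfl⟩ ⟨q', hq', ?_⟩
      rw [← hqq]
      simp only
      rw [smul_smul]
    · have h3 : diameter Mean.AM K C = 2 * d := by rw [hd]; ring
      have h4 : x - t + (-r) • c = x - (t + r • c) := by module
      simp only [h3] at hxc ⊢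
      rw [h4, ← hxc]
      module
  linarith

theorem inradius_add_circumradius_le [Nontrivial (E n)] (hK : IsCompact K)
    (hK' : K.Nonempty) (hC : IsGaugeBody C) (hC' : MinkowskiCentered C) (M : Mean) :
    inradius K C + circumradius K C ≤
      circumradius (symmetrization M C) C * diameter M K C := by
  have hB := isSymmBody_min hC
  have hM := isSymmBody_symmetrization hC M
  have hD := diameter_nonneg hK hK' hC M
  have hR : 0 ≤ circumradius (symmetrization M C) C := circumradius_nonneg _ _
  have hMR := symmetrization_subset_circumradius_smul hC hC' M
  set R := circumradius (symmetrization M C) C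
  have hMB : symmetrization M C ⊆ R • symmetrization Mean.MIN C := by
    -- Since `C_M` is symmetric, lying in `R C` means lying in `-R C` as well. That the inclusion in
    -- `R C` needs no translation is where centeredness enters.
    intro x hx
    rw [hB.mem_smul_iff hR, gauge_symmetrization_MIN hC]
    exact max_le (gauge_le_of_mem hR (hMR hx)) (gauge_le_of_mem hR (hMR (hM.neg_mem x hx)))
  have hKB : ∀ x ∈ K, ∀ y ∈ K,
      x - y ∈ (R * diameter M K C) • symmetrization Mean.MIN C := fun x hx y hy =>
    smul_subset_smul_mul hMB (mul_comm _ _) (sub_mem_diameter_smul hK hK' hC M hx hy)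
  set m := R * diameter M K C
  have hm : 0 ≤ m := by positivity
  rw [← le_sub_iff_add_le]
  refine inradius_le hK' ⟨0, hC.zero_mem⟩ fun r hr t h => ?_
  rw [le_sub_comm]
  have hrm : 2 * r ≤ m := by
    refine le_of_smul_subset_smul hB.toIsGaugeBody hm ?_
    rintro _ ⟨b, hb, rfl⟩
    have h1 := hKB _ (add_smul_mem_of_translate_subset h hb.1) _
      (add_smul_mem_of_translate_subset h (hB.neg_mem b hb).1)
    have h2 : t + r • b - (t + r • -b) = (2 * r) • b := by module
    rwa [h2] at h1
  have hrm' : 0 ≤ m - r := by linarith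
  refine circumradius_le hrm' t fun x hx => mem_singleton_add.2 ?_
  refine Set.smul_set_mono (fun b hb => hb.1 : symmetrization Mean.MIN C ⊆ C) ?_
  refine mem_of_forall_add_mem (B := r • symmetrization Mean.MIN C) (hB.convex.smul _)
    (hB.isCompact.smul _).isClosed (hB.isCompact.smul _) ⟨_, 0, hB.zero_mem, rfl⟩ ?_
  rintro _ ⟨b, hb, rfl⟩
  -- Symmetry of `C_MIN` gives `t - r b ∈ K`, so `x - t + r b` is a difference of points of `K`.
  have h1 := hKB x hx _ (add_smul_mem_of_translate_subset h (hB.neg_mem b hb).1)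
  have h2 : x - (t + r • -b) = x - t + r • b := by module
  rw [h2, ← sub_add_cancel m r, hB.convex.add_smul hrm' hr] at h1
  obtain ⟨a, ha, b', hb', hab⟩ := h1
  exact ⟨a, ha, b', hb', hab.symm⟩

theorem existsUnique_isRho [Nontrivial (E n)] (hC : IsGaugeBody C) (M : Mean) :
    ∃! r : ℝ, IsRho M C r := by
  have hM := isSymmBody_symmetrization hC M
  have hA := isSymmBody_am hC
  have hpos := circumradius_pos hM hA
  refine ⟨(circumradius (symmetrization M C) (symmetrization Mean.AM C))⁻¹,
    ⟨inv_pos.2 hpos, ?_⟩, fun r hr => ?_⟩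
  · rw [optContained_smul_left_iff hM hA (inv_pos.2 hpos), inv_mul_cancel₀ hpos.ne']
  · exact eq_inv_of_mul_eq_one_left ((optContained_smul_left_iff hM hA hr.1).1 hr.2)

theorem existsUnique_isDelta [Nontrivial (E n)] (hC : IsGaugeBody C) (M : Mean) :
    ∃! d : ℝ, IsDelta M C d := by
  have hM := isSymmBody_symmetrization hC M
  have hA := isSymmBody_am hC
  have hpos := circumradius_pos hA hM
  exact ⟨circumradius (symmetrization Mean.AM C) (symmetrization M C),
    ⟨hpos, (optContained_smul_right_iff hA hM hpos).2 rfl⟩,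
    fun d hd => (optContained_smul_right_iff hA hM hd.1).1 hd.2⟩

end Radii

end GaugeGeometry

theorem mainTheorem9 {n : ℕ} (hn : 2 ≤ n) (K C : Set (EuclideanSpace ℝ (Fin n)))
    (hK_ne : K.Nonempty) (hK_comp : IsCompact K) (hK_conv : Convex ℝ K)
    (hC_comp : IsCompact C) (hC_conv : Convex ℝ C) (hC_zero : 0 ∈ interior C)
    (hC_cent : MinkowskiCentered C) (M : Mean) :
    (∃! ρ : ℝ, IsRho M C ρ) ∧ (∃! δ : ℝ, IsDelta M C δ) ∧
    ∀ ρ δ : ℝ, IsRho M C ρ → IsDelta M C δ →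
      ρ ≤ δ ∧
      (ρ * diameter Mean.AM K C ≤ diameter M K C ∧
        diameter M K C ≤ δ * diameter Mean.AM K C) ∧
      δ * inradius K C ≤ diameter M K C / 2 ∧
      diameter M K C / 2 ≤ δ * circumradius K C ∧
      ρ * (asymmetry C * inradius K C + circumradius K C) ≤
        (asymmetry C + 1) * (diameter M K C / 2) ∧
      inradius K C + circumradius K C ≤
        circumradius (symmetrization M C) C * diameter M K C := by
  have hC : IsGaugeBody C := ⟨hC_conv, hC_comp, hC_zero⟩
  -- Positive dimension makes the space nontrivial, as the lemmas require.
  have : Nonempty (Fin n) := ⟨⟨0, by lia⟩⟩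
  refine ⟨existsUnique_isRho hC M, existsUnique_isDelta hC M, fun ρ δ hρ hδ => ?_⟩
  have h1 := mul_diameter_AM_le hK_comp hK_ne hC M hρ.1 hρ.2.1
  refine ⟨le_of_smul_subset_smul (isSymmBody_symmetrization hC M).toIsGaugeBody hδ.1.le
    (hρ.2.1.trans hδ.2.1), ⟨h1, diameter_le_mul_diameter_AM hK_comp hK_ne hC M hδ.1 hδ.2.1⟩,
    mul_inradius_le hK_comp hK_ne hC M hδ,
    diameter_le_mul_circumradius hK_comp hK_ne hC M hδ.1 hδ.2.1, ?_,
    inradius_add_circumradius_le hK_comp hK_ne hC hC_cent M⟩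
  have h2 := mul_le_mul_of_nonneg_left
    (asymmetry_mul_inradius_add_circumradius_le hK_comp hK_ne hC hC_cent) hρ.1.le
  have h3 := mul_le_mul_of_nonneg_left h1
    (add_nonneg (circumradius_nonneg C (-C)) zero_le_one : 0 ≤ asymmetry C + 1)
  linarith
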